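/- All graphs are finite, simple, undirected and have at least one vertex. For a graph $G$ on $n\ge 1$ vertices let $\lambda_n(G)$ denote the least eigenvalue of its adjacency matrix, let $C_t$ denote the cycle on $t$ vertices, and let $K_{a,b}$ denote the complete bipartite graph with parts of sizes $a$ and $b$. A graph is $C_t$-free if it does not contain $C_t$ as a (not necessarily induced) subgraph. Let $t\ge 3$ and let $G$ be a $C_t$-free graph on $n$ vertices. (i) If $t$ is odd or $n<t$, then $\lambda_n(G)\ge -\sqrt{\lfloor n/2\rfloor\lceil n/2\rceil}$, and equality holds if and only if $G\cong K_{\lfloor n/2\rfloor,\lceil n/2\rceil}$. (ii) If $t=2k+2$ for an integer $k$ and $n\ge t$, then $\lambda_n(G)\ge -\sqrt{k(n-k)}$, and equality holds if and only if $G\cong K_{k,n-k}$. -/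

import Mathlib

/-- The least eigenvalue of the adjacency matrix of a finite graph `G` (meaningful when `V` is
nonempty, see `leastEigenvalue_isLeast`). -/
noncomputable def leastEigenvalue {V : Type*} [Fintype V] [DecidableEq V]
    (G : SimpleGraph V) [DecidableRel G.Adj] : ℝ :=
  sInf (spectrum ℝ (G.adjMatrix ℝ))

theorem leastEigenvalue_isLeast {V : Type*} [Fintype V] [DecidableEq V] [Nonempty V]
    (G : SimpleGraph V) [DecidableRel G.Adj] :
    IsLeast (spectrum ℝ (G.adjMatrix ℝ)) (leastEigenvalue G) := by
  have h := (G.isHermitian_adjMatrix ℝ).spectrum_real_eq_range_eigenvalues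
  have hf : (spectrum ℝ (G.adjMatrix ℝ)).Finite := h ▸ Set.finite_range _
  have hn : (spectrum ℝ (G.adjMatrix ℝ)).Nonempty := h ▸ Set.range_nonempty _
  exact ⟨hn.csInf_mem hf, fun _ hx => csInf_le hf.bddBelow hx⟩

/-!
Let `x` be an eigenvector for the least eigenvalue `-μ`, and let `H` be the bipartite graph formed
by the edges of `G` across which `x` changes sign. Then `μ |x v| ≤ ∑ |x u|` over the neighbours `u`
of `v` in `H`; applying this twice at a vertex `v` maximising `|x v|` bounds `μ ^ 2` by the number
of walks of length two in `H` starting at `v`. If there are more than `k (n - k)` of them, where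
`2 k ≤ n`, then enough edges run between the neighbours and the second neighbours of `v` to contain
a path of length `2 k` between two neighbours of `v`, and `v` closes it to a cycle of length
`2 k + 2`. In the case of equality all these estimates are tight, which forces `G = H` and makes `H`
complete bipartite. On `n` vertices cycles of length `2 ⌊n / 2⌋ + 2` do not exist, so
`k = ⌊n / 2⌋` gives the bound for arbitrary graphs.
-/

open Finset SimpleGraph

section Paths

variable {V : Type*} {G : SimpleGraph V}

theorem free_of_card_lt {W : Type*} [Fintype V] [Fintype W] {H : SimpleGraph W}
    (h : Fintype.card V < Fintype.card W) : H.Free G := fun hHG =>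
  h.not_ge <| bot_isContained_iff_card_le.mp <| hHG.mono_left bot_le

theorem cycleGraph_isContained_of_isPath {a b v : V} (p : G.Walk a b) (hp : p.IsPath) (hab : a ≠ b)
    (ha : G.Adj v a) (hb : G.Adj b v) (hv : v ∉ p.support) :
    cycleGraph (p.length + 2) ⊑ G := by
  have hlen : p.length ≠ 0 := fun h => hab (Walk.eq_of_length_eq_zero h)
  refine (cycleGraph_isContained_iff (by omega)).mpr ⟨b, .cons hb (.cons ha p), ?_, by simp⟩
  refine Walk.cons_isCycle_iff _ _ |>.mpr ⟨hp.cons hv, fun h => ?_⟩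
  rcases List.mem_cons.mp (Walk.edges_cons ha p ▸ h) with h | h
  · rw [Sym2.eq_swap, Sym2.congr_right] at h
    exact hab h.symm
  · exact hv (p.snd_mem_support_of_mem_edges h)

variable [DecidableRel G.Adj]

theorem card_interedges_eq_sum (A B : Finset V) :
    #(G.interedges A B) = ∑ a ∈ A, #{b ∈ B | G.Adj a b} := by
  simp only [interedges_def, card_filter, sum_product]

theorem card_interedges_eq_sum_right (A B : Finset V) :
    #(G.interedges A B) = ∑ b ∈ B, #{a ∈ A | G.Adj a b} := by
  simp only [interedges_def, card_filter, sum_product_right]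

variable [DecidableEq V]

-- Greedy extension: the path has used at most `m` vertices of `B` and at most `m + 1` of `A`, so
-- its current end has a new neighbour in `B`, which in turn has a new neighbour in `A`.
theorem exists_isPath_of_forall_le_card_filter_adj {A B : Finset V} (hAB : Disjoint A B)
    (hA : A.Nonempty) {m : ℕ} (hdA : ∀ a ∈ A, m ≤ #{b ∈ B | G.Adj a b})
    (hdB : ∀ b ∈ B, m + 1 ≤ #{a ∈ A | G.Adj a b}) :
    ∃ a ∈ A, ∃ a' ∈ A, ∃ p : G.Walk a a', p.IsPath ∧ p.length = 2 * m ∧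
      (∀ w ∈ p.support, w ∈ A ∪ B) ∧
      #{w ∈ A | w ∈ p.support} ≤ m + 1 ∧ #{w ∈ B | w ∈ p.support} ≤ m := by
  induction m with
  | zero =>
    obtain ⟨a, ha⟩ := hA
    have haB : a ∉ B := Finset.disjoint_left.mp hAB ha
    exact ⟨a, ha, a, ha, .nil, by simp, by simp, by simp [ha], by simp [filter_eq', ha],
      by simp [filter_eq', haB]⟩
  | succ m ih =>
    obtain ⟨a, ha, a', ha', p, hp, hlen, hsupp, hpA, hpB⟩ :=
      ih (fun a ha => m.le_succ.trans (hdA a ha)) (fun b hb => (m + 1).le_succ.trans (hdB b hb))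
    obtain ⟨b, hb, hbp⟩ := exists_mem_notMem_of_card_lt_card (hpB.trans_lt (hdA a ha))
    obtain ⟨hbB, hab⟩ := mem_filter.mp hb
    obtain ⟨c, hc, hcp⟩ := exists_mem_notMem_of_card_lt_card (hpA.trans_lt (hdB b hbB))
    obtain ⟨hcA, hcb⟩ := mem_filter.mp hc
    have hbA : b ∉ A := Finset.disjoint_right.mp hAB hbB
    have hcB : c ∉ B := Finset.disjoint_left.mp hAB hcA
    replace hbp : b ∉ p.support := fun h => hbp (mem_filter.mpr ⟨hbB, h⟩)
    replace hcp : c ∉ p.support := fun h => hcp (mem_filter.mpr ⟨hcA, h⟩)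
    refine ⟨c, hcA, a', ha', .cons hcb (.cons hab.symm p), ?_, ?_, ?_, ?_, ?_⟩
    · simp [Walk.cons_isPath_iff, hp, hbp, hcp, hcb.ne]
    · simp only [Walk.length_cons, hlen]
      ring
    · simpa [hcA, hbB] using hsupp
    · refine (card_le_card (t := insert c {w ∈ A | w ∈ p.support}) fun w hw => ?_).trans
        ((card_insert_le _ _).trans (by omega))
      simp only [Walk.support_cons, List.mem_cons, mem_filter, mem_insert] at hw ⊢
      grind
    · refine (card_le_card (t := insert b {w ∈ B | w ∈ p.support}) fun w hw => ?_).trans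
        ((card_insert_le _ _).trans (by omega))
      simp only [Walk.support_cons, List.mem_cons, mem_filter, mem_insert] at hw ⊢
      grind

-- Vertices of `A` with at most `j` neighbours in `B`, and vertices of `B` with at most `j + 1`
-- neighbours in `A`, can be deleted without destroying the hypothesis on the number of edges.
theorem exists_isPath_of_lt_card_interedges {A B : Finset V} (hAB : Disjoint A B) {j : ℕ}
    (hA : j + 1 ≤ #A) (hB : j ≤ #B)
    (h : j * #A + (j + 1) * #B < #(G.interedges A B) + j * (j + 1)) :
    ∃ a ∈ A, ∃ a' ∈ A, ∃ p : G.Walk a a', p.IsPath ∧ p.length = 2 * (j + 1) ∧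
      ∀ w ∈ p.support, w ∈ A ∪ B := by
  induction hN : #A + #B generalizing A B with
  | zero => omega
  | succ N ih =>
    have htriv := G.card_interedges_le_mul A B
    rcases hA.eq_or_lt with hA | hA
    · rw [← hA] at h htriv
      nlinarith
    rcases hB.eq_or_lt with hB | hB
    · rw [← hB] at h htriv
      nlinarith
    by_cases! hlowA : ∃ a ∈ A, #{b ∈ B | G.Adj a b} ≤ j
    · obtain ⟨a, ha, hda⟩ := hlowA
      have hcard := card_erase_add_one ha
      have hedges : #(G.interedges (A.erase a) B) + #{b ∈ B | G.Adj a b} = #(G.interedges A B) := by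
        simp only [card_interedges_eq_sum, sum_erase_add _ _ ha]
      obtain ⟨x, hx, y, hy, p, hp, hlen, hsupp⟩ := ih (hAB.mono_left (erase_subset a A))
        (by omega) hB.le (by rw [← hcard] at h; nlinarith) (by omega)
      exact ⟨x, mem_of_mem_erase hx, y, mem_of_mem_erase hy, p, hp, hlen,
        fun w hw => union_subset_union_left (erase_subset _ _) (hsupp w hw)⟩
    by_cases! hlowB : ∃ b ∈ B, #{a ∈ A | G.Adj a b} ≤ j + 1
    · obtain ⟨b, hb, hdb⟩ := hlowB
      have hcard := card_erase_add_one hb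
      have hedges : #(G.interedges A (B.erase b)) + #{a ∈ A | G.Adj a b} = #(G.interedges A B) := by
        simp only [card_interedges_eq_sum_right, sum_erase_add _ _ hb]
      obtain ⟨x, hx, y, hy, p, hp, hlen, hsupp⟩ := ih (hAB.mono_right (erase_subset b B))
        hA.le (by omega) (by rw [← hcard] at h; nlinarith) (by omega)
      exact ⟨x, hx, y, hy, p, hp, hlen,
        fun w hw => union_subset_union_right (erase_subset _ _) (hsupp w hw)⟩
    obtain ⟨a, ha, a', ha', p, hp, hlen, hsupp, -, -⟩ :=
      exists_isPath_of_forall_le_card_filter_adj hAB (card_pos.mp (by omega)) hlowA hlowB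
    exact ⟨a, ha, a', ha', p, hp, hlen, hsupp⟩

end Paths

section TwoWalks

variable {V : Type*} [Fintype V] [DecidableEq V] (G : SimpleGraph V) [DecidableRel G.Adj] (v : V)

/-- The vertices other than `v` joined to `v` by a walk of length two. They may include neighbours
of `v`, but do not if `G` is triangle-free. -/
def secondNeighborFinset : Finset V := {w | w ≠ v ∧ ∃ u, G.Adj v u ∧ G.Adj u w}

/-- The vertices at distance at most two from `v`. -/
def twoBall : Finset V := insert v (G.neighborFinset v ∪ secondNeighborFinset G v)

variable {G v}

theorem mem_twoBall {w : V} :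
    w ∈ twoBall G v ↔ w = v ∨ G.Adj v w ∨ ∃ u, G.Adj v u ∧ G.Adj u w := by
  simp only [twoBall, secondNeighborFinset, mem_insert, mem_union, mem_neighborFinset, mem_filter,
    mem_univ, true_and]
  tauto

theorem disjoint_neighborFinset_secondNeighborFinset (hG : G.CliqueFree 3) :
    Disjoint (G.neighborFinset v) (secondNeighborFinset G v) := by
  refine Finset.disjoint_left.mpr fun w hw hw' => ?_
  obtain ⟨-, u, hvu, huw⟩ := (mem_filter.mp hw').2
  exact hG {v, u, w} (is3Clique_triple_iff.mpr ⟨hvu, (mem_neighborFinset _ _ _).mp hw, huw⟩)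

theorem notMem_neighborFinset_union_secondNeighborFinset :
    v ∉ G.neighborFinset v ∪ secondNeighborFinset G v := by
  simp [secondNeighborFinset]

theorem card_twoBall (hG : G.CliqueFree 3) :
    #(twoBall G v) = G.degree v + #(secondNeighborFinset G v) + 1 := by
  rw [twoBall, card_insert_of_notMem notMem_neighborFinset_union_secondNeighborFinset,
    card_union_of_disjoint (disjoint_neighborFinset_secondNeighborFinset hG),
    card_neighborFinset_eq_degree]

theorem sum_degree_neighborFinset_eq :
    ∑ u ∈ G.neighborFinset v, G.degree u =
      G.degree v + #(G.interedges (G.neighborFinset v) (secondNeighborFinset G v)) := by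
  rw [card_interedges_eq_sum, ← card_neighborFinset_eq_degree, card_eq_sum_ones, ← sum_add_distrib]
  refine sum_congr rfl fun u hu => ?_
  have hvu : G.Adj v u := (mem_neighborFinset _ _ _).mp hu
  have : G.neighborFinset u = insert v {w ∈ secondNeighborFinset G v | G.Adj u w} := by
    ext w
    rw [mem_neighborFinset, mem_insert, mem_filter, secondNeighborFinset, mem_filter_univ]
    by_cases hw : w = v
    · simp [hw, hvu.symm]
    · exact ⟨fun h => .inr ⟨⟨hw, u, hvu, h⟩, h⟩, fun h => (h.resolve_left hw).2⟩
  rw [← card_neighborFinset_eq_degree, this, card_insert_of_notMem (by simp [secondNeighborFinset]),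
    add_comm]

theorem mul_lt_mul_of_lt_of_add_le_add {c d k m : ℕ} (hc : c < k) (hkm : k ≤ m)
    (h : c + d ≤ k + m) : c * d < k * m := by
  zify at *
  nlinarith [mul_pos (sub_pos.mpr hc) (sub_pos.mpr (hc.trans_le hkm))]

theorem sum_degree_neighborFinset_add_le {k : ℕ} (hk : 0 < k) (hG : G.CliqueFree 3)
    (hfree : (cycleGraph (2 * k + 2)).Free G) (hdeg : k ≤ G.degree v)
    (hsec : k ≤ #(secondNeighborFinset G v) + 1) :
    ∑ u ∈ G.neighborFinset v, G.degree u + k * k ≤ k * #(twoBall G v) := by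
  obtain ⟨j, rfl⟩ := Nat.exists_eq_add_one.mpr hk
  rw [← card_neighborFinset_eq_degree] at hdeg
  have hedges : ¬ j * #(G.neighborFinset v) + (j + 1) * #(secondNeighborFinset G v) <
      #(G.interedges (G.neighborFinset v) (secondNeighborFinset G v)) + j * (j + 1) := fun h => by
    obtain ⟨a, ha, b, hb, p, hp, hlen, hsupp⟩ := exists_isPath_of_lt_card_interedges
      (disjoint_neighborFinset_secondNeighborFinset hG) hdeg (by omega) h
    have hab : a ≠ b := by
      rintro rfl
      simp [Walk.length_eq_zero_iff.mpr (Walk.isPath_iff_nil.mp hp)] at hlen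
    rw [mem_neighborFinset] at ha hb
    have := cycleGraph_isContained_of_isPath p hp hab ha hb.symm
      fun hv => notMem_neighborFinset_union_secondNeighborFinset (hsupp v hv)
    exact hfree (hlen ▸ this)
  rw [card_neighborFinset_eq_degree] at hedges
  rw [sum_degree_neighborFinset_eq, card_twoBall hG]
  nlinarith

theorem sum_degree_neighborFinset_lt_or_add_le {k m : ℕ} (hk : 0 < k) (hkm : k ≤ m)
    (hV : Fintype.card V = k + m) (hG : G.CliqueFree 3)
    (hfree : (cycleGraph (2 * k + 2)).Free G) (v : V) :
    ∑ u ∈ G.neighborFinset v, G.degree u < k * m ∨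
      ∑ u ∈ G.neighborFinset v, G.degree u + k * k ≤ k * #(twoBall G v) := by
  have htriv : ∑ u ∈ G.neighborFinset v, G.degree u ≤
      G.degree v * (#(secondNeighborFinset G v) + 1) := by
    have := G.card_interedges_le_mul (G.neighborFinset v) (secondNeighborFinset G v)
    rw [card_neighborFinset_eq_degree] at this
    rw [sum_degree_neighborFinset_eq]
    linarith
  have hcard : G.degree v + (#(secondNeighborFinset G v) + 1) ≤ k + m := by
    rw [← add_assoc, ← card_twoBall hG, ← hV]
    exact card_le_univ _
  rcases lt_or_ge (G.degree v) k with hdeg | hdeg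
  · exact .inl (htriv.trans_lt (mul_lt_mul_of_lt_of_add_le_add hdeg hkm hcard))
  rcases lt_or_ge (#(secondNeighborFinset G v) + 1) k with hsec | hsec
  · rw [mul_comm] at htriv
    rw [add_comm] at hcard
    exact .inl (htriv.trans_lt (mul_lt_mul_of_lt_of_add_le_add hsec hkm hcard))
  · exact .inr (sum_degree_neighborFinset_add_le hk hG hfree hdeg hsec)

omit [DecidableEq V] in
theorem sum_degree_neighborFinset_le {k m : ℕ} (hk : 0 < k) (hkm : k ≤ m)
    (hV : Fintype.card V = k + m) (hG : G.CliqueFree 3)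
    (hfree : (cycleGraph (2 * k + 2)).Free G) (v : V) :
    ∑ u ∈ G.neighborFinset v, G.degree u ≤ k * m := by
  classical
  have hcard : #(twoBall G v) ≤ k + m := hV ▸ card_le_univ _
  rcases sum_degree_neighborFinset_lt_or_add_le hk hkm hV hG hfree v with h | h
  · exact h.le
  · nlinarith

theorem twoBall_eq_univ_of_sum_degree_neighborFinset_eq {k m : ℕ} (hk : 0 < k) (hkm : k ≤ m)
    (hV : Fintype.card V = k + m) (hG : G.CliqueFree 3)
    (hfree : (cycleGraph (2 * k + 2)).Free G)
    (heq : ∑ u ∈ G.neighborFinset v, G.degree u = k * m) : twoBall G v = univ := by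
  rw [← card_eq_iff_eq_univ]
  refine le_antisymm (card_le_univ _) ?_
  rcases sum_degree_neighborFinset_lt_or_add_le hk hkm hV hG hfree v with h | h
  · exact absurd heq h.ne
  · rw [hV]
    nlinarith

end TwoWalks

section CompleteBipartite

variable {V : Type*} {G : SimpleGraph V} {s : Finset V}

theorem nonempty_iso_completeBipartiteGraph [Fintype V] [DecidableEq V] {a b : ℕ}
    (h : ∀ u v, G.Adj u v ↔ (u ∈ s ↔ v ∉ s)) (ha : #s = a) (hb : #sᶜ = b) :
    Nonempty (G ≃g completeBipartiteGraph (Fin a) (Fin b)) := by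
  have e₁ : {v // v ∈ s} ≃ Fin a := s.equivFinOfCardEq ha
  have e₂ : {v // v ∉ s} ≃ Fin b :=
    (Equiv.subtypeEquivRight fun v => mem_compl.symm).trans (sᶜ.equivFinOfCardEq hb)
  refine ⟨⟨(Equiv.sumCompl (· ∈ s)).symm.trans (e₁.sumCongr e₂), fun {u v} => ?_⟩⟩
  rw [h]
  by_cases hu : u ∈ s <;> by_cases hv : v ∈ s <;>
    simp [hu, hv, Equiv.sumCompl_symm_apply_of_pos, Equiv.sumCompl_symm_apply_of_neg]

theorem nonempty_iso_completeBipartiteGraph_of_card_mul_card_compl [Fintype V] [DecidableEq V]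
    {a b : ℕ} (h : ∀ u v, G.Adj u v ↔ (u ∈ s ↔ v ∉ s)) (hV : Fintype.card V = a + b)
    (hs : #s * #sᶜ = a * b) : Nonempty (G ≃g completeBipartiteGraph (Fin a) (Fin b)) := by
  have hcard : #s + #sᶜ = a + b := by rw [card_add_card_compl, hV]
  have hroots : ((#s : ℤ) - a) * (#s - b) = 0 := by
    zify at hcard hs
    linear_combination (#s : ℤ) * hcard - hs
  rcases mul_eq_zero.mp hroots with ha | hb
  · exact nonempty_iso_completeBipartiteGraph h (by omega) (by omega)
  · refine nonempty_iso_completeBipartiteGraph (s := sᶜ) (fun u v => ?_) (by omega)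
      (by rw [compl_compl]; omega)
    rw [h, mem_compl, mem_compl]
    tauto

theorem sum_degree_neighborFinset_of_adj_iff [Fintype V] [DecidableEq V] [DecidableRel G.Adj]
    (h : ∀ u v, G.Adj u v ↔ (u ∈ s ↔ v ∉ s)) (v : V) :
    ∑ u ∈ G.neighborFinset v, G.degree u = #s * #sᶜ := by
  have hin : ∀ u ∈ s, G.neighborFinset u = sᶜ := fun u hu => by ext w; simp [h, hu]
  have hout : ∀ u ∈ sᶜ, G.neighborFinset u = s := fun u hu => by
    ext w; simp [h, mem_compl.mp hu]
  simp only [← card_neighborFinset_eq_degree]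
  by_cases hv : v ∈ s
  · rw [hin v hv, sum_congr rfl fun u hu => congrArg card (hout u hu), sum_const, smul_eq_mul,
      mul_comm]
  · rw [hout v (mem_compl.mpr hv), sum_congr rfl fun u hu => congrArg card (hin u hu), sum_const,
      smul_eq_mul]

end CompleteBipartite

section Spectrum

theorem mem_spectrum_iff_exists_mulVec_eq_smul {K n : Type*} [Field K] [Fintype n]
    [DecidableEq n] {A : Matrix n n K} {c : K} :
    c ∈ spectrum K A ↔ ∃ x ≠ 0, A.mulVec x = c • x := by
  rw [← Matrix.spectrum_toLin', ← Module.End.hasEigenvalue_iff_mem_spectrum]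
  refine ⟨fun h => ?_, fun ⟨x, hx, hAx⟩ => ?_⟩
  · obtain ⟨x, hx⟩ := h.exists_hasEigenvector
    exact ⟨x, hx.2, hx.apply_eq_smul⟩
  · exact Module.End.hasEigenvalue_of_hasEigenvector
      (Module.End.hasEigenvector_iff.mpr ⟨Module.End.mem_eigenspace_iff.mpr hAx, hx⟩)

variable {V : Type*} [Fintype V] [DecidableEq V] {G : SimpleGraph V} [DecidableRel G.Adj]

theorem mem_spectrum_adjMatrix_iff {c : ℝ} :
    c ∈ spectrum ℝ (G.adjMatrix ℝ) ↔
      ∃ x : V → ℝ, x ≠ 0 ∧ ∀ v, ∑ u ∈ G.neighborFinset v, x u = c * x v := by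
  simp only [mem_spectrum_iff_exists_mulVec_eq_smul, funext_iff, adjMatrix_mulVec_apply,
    Pi.smul_apply, smul_eq_mul, ne_eq]

theorem leastEigenvalue_bot [Nonempty V] [DecidableRel (⊥ : SimpleGraph V).Adj] :
    leastEigenvalue (⊥ : SimpleGraph V) = 0 := by
  have : (⊥ : SimpleGraph V).adjMatrix ℝ = 0 := by
    ext
    simp
  rw [leastEigenvalue, this, spectrum.zero_eq, csInf_singleton]

theorem spectrum_adjMatrix_eq_of_iso {W : Type*} [Fintype W] [DecidableEq W]
    {H : SimpleGraph W} [DecidableRel H.Adj] (e : G ≃g H) :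
    spectrum ℝ (G.adjMatrix ℝ) = spectrum ℝ (H.adjMatrix ℝ) := by
  rw [← Iso.reindex_adjMatrix ℝ e]
  exact (AlgEquiv.spectrum_eq (Matrix.reindexAlgEquiv ℝ ℝ e.toEquiv) _).symm

theorem neg_sqrt_mem_spectrum_adjMatrix_completeBipartiteGraph {V W : Type*} [Fintype V]
    [Fintype W] [DecidableEq V] [DecidableEq W] [Nonempty V] [Nonempty W]
    [DecidableRel (completeBipartiteGraph V W).Adj] :
    -√((Fintype.card V : ℝ) * Fintype.card W) ∈
      spectrum ℝ ((completeBipartiteGraph V W).adjMatrix ℝ) := by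
  set a : ℝ := (Fintype.card V : ℝ)
  set b : ℝ := (Fintype.card W : ℝ)
  have ha : √a * √a = a := Real.mul_self_sqrt (Nat.cast_nonneg _)
  have hb : √b * √b = b := Real.mul_self_sqrt (Nat.cast_nonneg _)
  rw [mem_spectrum_adjMatrix_iff, Real.sqrt_mul (Nat.cast_nonneg _)]
  refine ⟨Sum.elim (fun _ => √b) (fun _ => -√a), fun h => ?_, ?_⟩
  · have : √b = 0 := congrFun h (Sum.inl (Classical.arbitrary V))
    simp [b] at this
  · simp only [neighborFinset_eq_filter, sum_filter, Fintype.sum_sum_type]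
    rintro (v | w)
    · have : b * √a = √a * √b * √b := by rw [mul_assoc, hb, mul_comm]
      simpa using this
    · have : a * √b = √a * √b * √a := by rw [mul_right_comm, ha]
      simpa using this

variable (G) in
theorem exists_eigenvector_leastEigenvalue_abs_max [Nonempty V] :
    ∃ (x : V → ℝ) (v : V), (∀ w, ∑ u ∈ G.neighborFinset w, x u = leastEigenvalue G * x w) ∧
      0 < |x v| ∧ ∀ w, |x w| ≤ |x v| := by
  obtain ⟨x, hx, hGx⟩ := mem_spectrum_adjMatrix_iff.mp (leastEigenvalue_isLeast G).1
  obtain ⟨w, hw⟩ := Function.ne_iff.mp hx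
  obtain ⟨v, hv⟩ := Finite.exists_max fun w => |x w|
  exact ⟨x, v, hGx, (abs_pos.mpr hw).trans_le (hv w), hv⟩

end Spectrum

section SignCut

variable {V : Type*}

/-- The bipartite subgraph of `G` formed by the edges across which `x` changes sign, zero counting
as positive. -/
def signCut (G : SimpleGraph V) (x : V → ℝ) : SimpleGraph V :=
  G.between {v | 0 ≤ x v} {v | 0 ≤ x v}ᶜ

noncomputable instance signCut.instDecidableRelAdj (G : SimpleGraph V) (x : V → ℝ) :
    DecidableRel (signCut G x).Adj :=
  Classical.decRel _

variable {G : SimpleGraph V} {x : V → ℝ} {c : ℝ}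

theorem signCut_le : signCut G x ≤ G := between_le

theorem signCut_adj {u v : V} : (signCut G x).Adj u v ↔ G.Adj u v ∧ (0 ≤ x u ↔ ¬ 0 ≤ x v) := by
  rw [signCut, between_adj]
  simp only [Set.mem_ofPred_eq, Set.mem_compl_iff]
  tauto

theorem cliqueFree_three_signCut : (signCut G x).CliqueFree 3 :=
  Colorable.cliqueFree (between_isBipartite disjoint_compl_right) (by norm_num)

variable [Fintype V] [DecidableRel G.Adj]

theorem neg_mul_abs_add_sum_abs_eq {v : V} (hx : ∑ u ∈ G.neighborFinset v, x u = c * x v) :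
    -c * |x v| + ∑ u ∈ G.neighborFinset v with ¬ (signCut G x).Adj v u, |x u| =
      ∑ u ∈ (signCut G x).neighborFinset v, |x u| := by
  obtain ⟨σ, hv, hσ⟩ : ∃ σ : ℝ, σ * x v = |x v| ∧
      ∀ u, G.Adj v u → σ * x u = if (signCut G x).Adj v u then -|x u| else |x u| := by
    simp only [signCut_adj]
    rcases le_or_gt 0 (x v) with hv | hv
    · refine ⟨1, by rw [abs_of_nonneg hv, one_mul], fun u hu => ?_⟩
      split_ifs with h <;> grind
    · refine ⟨-1, by rw [abs_of_neg hv, neg_one_mul], fun u hu => ?_⟩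
      split_ifs with h <;> grind
  have hN : (signCut G x).neighborFinset v = {u ∈ G.neighborFinset v | (signCut G x).Adj v u} := by
    ext u
    simpa using fun h => signCut_le h
  have hsum : c * |x v| = ∑ u ∈ G.neighborFinset v, σ * x u := by
    rw [← mul_sum, hx, ← hv]
    ring
  rw [sum_congr rfl fun u hu => hσ u ((mem_neighborFinset _ _ _).mp hu), sum_ite,
    sum_neg_distrib, ← hN] at hsum
  linarith

theorem neg_mul_abs_le_sum_abs {v : V} (hx : ∑ u ∈ G.neighborFinset v, x u = c * x v) :
    -c * |x v| ≤ ∑ u ∈ (signCut G x).neighborFinset v, |x u| := by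
  rw [← neg_mul_abs_add_sum_abs_eq hx]
  exact le_add_of_nonneg_right (sum_nonneg fun _ _ => abs_nonneg _)

theorem signCut_eq_self_of_neg_mul_abs_eq
    (hx : ∀ v, ∑ u ∈ G.neighborFinset v, x u = c * x v) (hne : ∀ v, x v ≠ 0)
    (heq : ∀ v, -c * |x v| = ∑ u ∈ (signCut G x).neighborFinset v, |x u|) :
    signCut G x = G := by
  refine signCut_le.antisymm fun v u hvu => ?_
  by_contra hH
  have hzero : ∑ u ∈ G.neighborFinset v with ¬ (signCut G x).Adj v u, |x u| = 0 := by
    linarith [neg_mul_abs_add_sum_abs_eq (hx v), heq v]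
  have hu := (sum_eq_zero_iff_of_nonneg fun _ _ => abs_nonneg _).mp hzero u
    (mem_filter.mpr ⟨(mem_neighborFinset _ _ _).mpr hvu, hH⟩)
  exact hne u (abs_eq_zero.mp hu)

omit [DecidableRel G.Adj] in
theorem signCut_adj_of_twoBall_eq_univ [DecidableEq V] {u w : V}
    (hu : twoBall (signCut G x) u = univ) (huw : 0 ≤ x u ↔ ¬ 0 ≤ x w) :
    (signCut G x).Adj u w := by
  rcases mem_twoBall.mp (hu ▸ mem_univ w) with rfl | h | ⟨z, huz, hzw⟩
  · tauto
  · exact h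
  · have := (signCut_adj.mp huz).2
    have := (signCut_adj.mp hzw).2
    tauto

omit [DecidableRel G.Adj] in
theorem signCut_adj_iff_of_twoBall_eq_univ [DecidableEq V] {v : V}
    (hv : ∀ w, ¬ (signCut G x).Adj v w → twoBall (signCut G x) w = univ) (u w : V) :
    (signCut G x).Adj u w ↔ (0 ≤ x u ↔ ¬ 0 ≤ x w) := by
  refine ⟨fun h => (signCut_adj.mp h).2, fun huw => ?_⟩
  by_cases hvu : (signCut G x).Adj v u
  · have hvw : ¬ (signCut G x).Adj v w := fun hvw => by
      have := (signCut_adj.mp hvu).2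
      have := (signCut_adj.mp hvw).2
      tauto
    exact (signCut_adj_of_twoBall_eq_univ (hv w hvw) (by tauto)).symm
  · exact signCut_adj_of_twoBall_eq_univ (hv u hvu) huw

end SignCut

section Subeigenvector

variable {V : Type*} [Fintype V] {G : SimpleGraph V} [DecidableRel G.Adj]
  {y : V → ℝ} {μ : ℝ} {v : V}

theorem sq_mul_le_mul_sum_neighborFinset (hμ : 0 ≤ μ)
    (hy : ∀ v, μ * y v ≤ ∑ u ∈ G.neighborFinset v, y u) (v : V) :
    μ ^ 2 * y v ≤ μ * ∑ u ∈ G.neighborFinset v, y u := by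
  rw [sq, mul_assoc]
  exact mul_le_mul_of_nonneg_left (hy v) hμ

theorem mul_sum_neighborFinset_le_sum_sum
    (hy : ∀ v, μ * y v ≤ ∑ u ∈ G.neighborFinset v, y u) (v : V) :
    μ * ∑ u ∈ G.neighborFinset v, y u ≤
      ∑ u ∈ G.neighborFinset v, ∑ w ∈ G.neighborFinset u, y w := by
  rw [mul_sum]
  exact sum_le_sum fun u _ => hy u

theorem sum_sum_const_eq_sum_degree_mul (c : ℝ) :
    ∑ u ∈ G.neighborFinset v, ∑ _w ∈ G.neighborFinset u, c =
      (∑ u ∈ G.neighborFinset v, G.degree u : ℕ) * c := by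
  simp only [sum_const, card_neighborFinset_eq_degree, nsmul_eq_mul, Nat.cast_sum, sum_mul]

theorem sum_sum_neighborFinset_le (hmax : ∀ w, y w ≤ y v) :
    ∑ u ∈ G.neighborFinset v, ∑ w ∈ G.neighborFinset u, y w ≤
      (∑ u ∈ G.neighborFinset v, G.degree u : ℕ) * y v := by
  rw [← sum_sum_const_eq_sum_degree_mul]
  exact sum_le_sum fun u _ => sum_le_sum fun w _ => hmax w

theorem sq_le_sum_degree_neighborFinset (hμ : 0 ≤ μ)
    (hy : ∀ v, μ * y v ≤ ∑ u ∈ G.neighborFinset v, y u) (hpos : 0 < y v)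
    (hmax : ∀ w, y w ≤ y v) : μ ^ 2 ≤ (∑ u ∈ G.neighborFinset v, G.degree u : ℕ) :=
  le_of_mul_le_mul_right ((sq_mul_le_mul_sum_neighborFinset hμ hy v).trans <|
    (mul_sum_neighborFinset_le_sum_sum hy v).trans (sum_sum_neighborFinset_le hmax)) hpos

theorem mul_eq_sum_neighborFinset_of_sum_degree_le (hμ : 0 < μ)
    (hy : ∀ v, μ * y v ≤ ∑ u ∈ G.neighborFinset v, y u) (hpos : 0 < y v)
    (hmax : ∀ w, y w ≤ y v) (hdeg : (∑ u ∈ G.neighborFinset v, G.degree u : ℕ) ≤ μ ^ 2) :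
    μ * y v = ∑ u ∈ G.neighborFinset v, y u ∧
      (∀ u, G.Adj v u → μ * y u = ∑ w ∈ G.neighborFinset u, y w) ∧
      ∀ u, G.Adj v u → ∀ w, G.Adj u w → y w = y v := by
  have h₁ := sq_mul_le_mul_sum_neighborFinset hμ.le hy v
  have h₂ := mul_sum_neighborFinset_le_sum_sum hy v
  have h₃ := sum_sum_neighborFinset_le (G := G) hmax
  have h₄ := mul_le_mul_of_nonneg_right hdeg hpos.le
  have hsum : μ * y v = ∑ u ∈ G.neighborFinset v, y u :=
    mul_left_cancel₀ hμ.ne' (by linarith)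
  have hnbr : ∑ u ∈ G.neighborFinset v, μ * y u =
      ∑ u ∈ G.neighborFinset v, ∑ w ∈ G.neighborFinset u, y w := by
    rw [← mul_sum]
    linarith
  have hsecond : ∑ u ∈ G.neighborFinset v, ∑ w ∈ G.neighborFinset u, y w =
      ∑ u ∈ G.neighborFinset v, ∑ _w ∈ G.neighborFinset u, y v := by
    rw [sum_sum_const_eq_sum_degree_mul]
    linarith
  rw [sum_eq_sum_iff_of_le fun u _ => hy u] at hnbr
  rw [sum_eq_sum_iff_of_le fun u _ => sum_le_sum fun w _ => hmax w] at hsecond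
  simp only [sum_eq_sum_iff_of_le fun w _ => hmax w, mem_neighborFinset] at hnbr hsecond
  exact ⟨hsum, hnbr, hsecond⟩

theorem pos_and_mul_eq_sum_of_twoBall_eq_univ [DecidableEq V] (hμ : 0 < μ)
    (hy : ∀ v, μ * y v ≤ ∑ u ∈ G.neighborFinset v, y u) (hpos : 0 < y v)
    (hmax : ∀ w, y w ≤ y v)
    (hdeg : ∀ v, (∑ u ∈ G.neighborFinset v, G.degree u : ℕ) ≤ μ ^ 2)
    (hball : twoBall G v = univ) :
    (∀ w, 0 < y w ∧ μ * y w = ∑ u ∈ G.neighborFinset w, y u) ∧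
      ∀ w, ¬ G.Adj v w → y w = y v := by
  obtain ⟨-, hnbr, hsecond⟩ := mul_eq_sum_neighborFinset_of_sum_degree_le hμ hy hpos hmax (hdeg v)
  have heq : ∀ w, ¬ G.Adj v w → y w = y v := fun w hvw => by
    rcases mem_twoBall.mp (hball ▸ mem_univ w) with rfl | h | ⟨u, hvu, huw⟩
    · rfl
    · exact absurd h hvw
    · exact hsecond u hvu w huw
  refine ⟨fun w => ?_, heq⟩
  by_cases hvw : G.Adj v w
  · have hsum : 0 < μ * y w := by
      rw [hnbr w hvw]
      refine sum_pos (fun u hu => ?_) ⟨v, (mem_neighborFinset _ _ _).mpr hvw.symm⟩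
      rwa [hsecond w hvw u ((mem_neighborFinset _ _ _).mp hu)]
    exact ⟨pos_of_mul_pos_right hsum hμ.le, hnbr w hvw⟩
  · have hw := heq w hvw
    exact ⟨hw ▸ hpos, (mul_eq_sum_neighborFinset_of_sum_degree_le hμ hy (hw ▸ hpos)
      (fun z => hw ▸ hmax z) (hdeg w)).1⟩

theorem pos_and_mul_eq_sum_and_twoBall_eq_univ_of_sq_eq [DecidableEq V] {k m : ℕ} (hk : 0 < k)
    (hkm : k ≤ m) (hV : Fintype.card V = k + m) (hG : G.CliqueFree 3)
    (hfree : (cycleGraph (2 * k + 2)).Free G) (hμ : 0 < μ) (hμsq : μ ^ 2 = (k * m : ℕ))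
    (hy : ∀ v, μ * y v ≤ ∑ u ∈ G.neighborFinset v, y u) (hpos : 0 < y v)
    (hmax : ∀ w, y w ≤ y v) :
    (∀ w, 0 < y w ∧ μ * y w = ∑ u ∈ G.neighborFinset w, y u) ∧
      ∀ w, ¬ G.Adj v w →
        ∑ u ∈ G.neighborFinset w, G.degree u = k * m ∧ twoBall G w = univ := by
  have hle := sum_degree_neighborFinset_le hk hkm hV hG hfree
  have hextremal : ∀ w, y w = y v →
      ∑ u ∈ G.neighborFinset w, G.degree u = k * m ∧ twoBall G w = univ := fun w hw => by
    have hge := sq_le_sum_degree_neighborFinset hμ.le hy (hw ▸ hpos) fun z => hw ▸ hmax z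
    have heq := (hle w).antisymm (by exact_mod_cast hμsq ▸ hge)
    exact ⟨heq, twoBall_eq_univ_of_sum_degree_neighborFinset_eq hk hkm hV hG hfree heq⟩
  obtain ⟨htight, hfar⟩ := pos_and_mul_eq_sum_of_twoBall_eq_univ hμ hy hpos hmax
    (fun w => hμsq ▸ mod_cast hle w) (hextremal v rfl).2
  exact ⟨htight, fun w hvw => hextremal w (hfar w hvw)⟩

end Subeigenvector

section LeastEigenvalue

variable {V : Type*} [Fintype V] [DecidableEq V] [Nonempty V] {G : SimpleGraph V}
  [DecidableRel G.Adj] {k m : ℕ}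

theorem leastEigenvalue_le_of_iso_completeBipartiteGraph (hk : 0 < k) (hm : 0 < m)
    (e : G ≃g completeBipartiteGraph (Fin k) (Fin m)) : leastEigenvalue G ≤ -√((k : ℝ) * m) := by
  classical
  have : NeZero k := ⟨hk.ne'⟩
  have : NeZero m := ⟨hm.ne'⟩
  refine (leastEigenvalue_isLeast G).2 ?_
  rw [spectrum_adjMatrix_eq_of_iso e]
  simpa using neg_sqrt_mem_spectrum_adjMatrix_completeBipartiteGraph (V := Fin k) (W := Fin m)

theorem neg_sqrt_mul_le_leastEigenvalue (hk : 0 < k) (hkm : k ≤ m)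
    (hV : Fintype.card V = k + m) (hfree : (cycleGraph (2 * k + 2)).Free G) :
    -√((k : ℝ) * m) ≤ leastEigenvalue G := by
  obtain ⟨x, v, hx, hpos, hmax⟩ := exists_eigenvector_leastEigenvalue_abs_max G
  by_contra! hlt
  have hsq : (-leastEigenvalue G) ^ 2 ≤
      ∑ u ∈ (signCut G x).neighborFinset v, (signCut G x).degree u :=
    sq_le_sum_degree_neighborFinset (by linarith [Real.sqrt_nonneg ((k : ℝ) * m)])
      (fun w => neg_mul_abs_le_sum_abs (hx w)) hpos hmax
  have hwalks : (∑ u ∈ (signCut G x).neighborFinset v, (signCut G x).degree u : ℕ) ≤ k * m :=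
    sum_degree_neighborFinset_le hk hkm hV cliqueFree_three_signCut
      (fun h => hfree (h.mono_right signCut_le)) v
  have : -leastEigenvalue G ≤ √((k : ℝ) * m) :=
    Real.le_sqrt_of_sq_le (hsq.trans (mod_cast hwalks))
  linarith

theorem nonempty_iso_of_leastEigenvalue_eq (hk : 0 < k) (hkm : k ≤ m)
    (hV : Fintype.card V = k + m) (hfree : (cycleGraph (2 * k + 2)).Free G)
    (heq : leastEigenvalue G = -√((k : ℝ) * m)) :
    Nonempty (G ≃g completeBipartiteGraph (Fin k) (Fin m)) := by
  classical
  obtain ⟨x, v, hx, hpos, hmax⟩ := exists_eigenvector_leastEigenvalue_abs_max G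
  have hkmpos : (0 : ℝ) < k * m := mod_cast Nat.mul_pos hk (hk.trans_le hkm)
  have hμ : 0 < -leastEigenvalue G := by
    rw [heq, neg_neg]
    exact Real.sqrt_pos.mpr hkmpos
  have hμsq : (-leastEigenvalue G) ^ 2 = (k * m : ℕ) := by
    rw [heq, neg_neg, Real.sq_sqrt hkmpos.le, Nat.cast_mul]
  obtain ⟨htight, hfar⟩ := pos_and_mul_eq_sum_and_twoBall_eq_univ_of_sq_eq hk hkm hV
    cliqueFree_three_signCut (fun h => hfree (h.mono_right signCut_le)) hμ hμsq
    (fun w => neg_mul_abs_le_sum_abs (hx w)) hpos hmax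
  have hcut : signCut G x = G :=
    signCut_eq_self_of_neg_mul_abs_eq hx (fun w => abs_pos.mp (htight w).1) fun w => (htight w).2
  have hadj : ∀ u w, (signCut G x).Adj u w ↔
      (u ∈ ({z | 0 ≤ x z} : Finset V) ↔ w ∉ ({z | 0 ≤ x z} : Finset V)) := by
    simpa only [mem_filter_univ] using
      signCut_adj_iff_of_twoBall_eq_univ fun w hvw => (hfar w hvw).2
  have hparts := sum_degree_neighborFinset_of_adj_iff hadj v
  rw [(hfar v (signCut G x).irrefl).1] at hparts
  exact nonempty_iso_completeBipartiteGraph_of_card_mul_card_compl (hcut ▸ hadj) hV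
    hparts.symm

end LeastEigenvalue

theorem theorem1p3_general {V : Type*} [Fintype V] [DecidableEq V] [Nonempty V]
    (G : SimpleGraph V) [DecidableRel G.Adj] (n k : ℕ) (hn : Fintype.card V = n) (hk : 2 * k ≤ n)
    (hG : (cycleGraph (2 * k + 2)).Free G) :
    -√((k : ℝ) * ((n : ℝ) - k)) ≤ leastEigenvalue G ∧
      (leastEigenvalue G = -√((k : ℝ) * ((n : ℝ) - k)) ↔
        Nonempty (G ≃g completeBipartiteGraph (Fin k) (Fin (n - k)))) := by
  obtain ⟨m, rfl⟩ := Nat.exists_eq_add_of_le (show k ≤ n by omega)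
  rw [Nat.cast_add, add_sub_cancel_left, Nat.add_sub_cancel_left]
  rcases k.eq_zero_or_pos with rfl | hk₀
  · rw [mul_zero, zero_add, cycleGraph_two_eq_top, ← cliqueFree_iff_top_free, Fintype.card_fin,
      cliqueFree_two] at hG
    subst hG
    have hiso := nonempty_iso_completeBipartiteGraph (G := (⊥ : SimpleGraph V)) (s := ∅)
      (a := 0) (b := m) (by simp) rfl (by simpa using hn)
    simp [leastEigenvalue_bot, hiso]
  · have hle := neg_sqrt_mul_le_leastEigenvalue hk₀ (by omega) hn hG
    exact ⟨hle, nonempty_iso_of_leastEigenvalue_eq hk₀ (by omega) hn hG, fun ⟨e⟩ =>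
      (leastEigenvalue_le_of_iso_completeBipartiteGraph hk₀ (by omega) e).antisymm hle⟩

theorem ceil_natCast_div_two (n : ℕ) : ⌈(n : ℝ) / 2⌉₊ = n - n / 2 := by
  rcases n.even_or_odd' with ⟨m, rfl | rfl⟩
  · rw [show ((2 * m : ℕ) : ℝ) / 2 = m by push_cast; ring, Nat.ceil_natCast]
    omega
  · rw [show 2 * m + 1 - (2 * m + 1) / 2 = m + 1 by omega, Nat.ceil_eq_iff (by omega)]
    constructor <;> push_cast [Nat.add_sub_cancel] <;> linarith

theorem neg_sqrt_floor_mul_ceil_le_leastEigenvalue_and_eq_iff {V : Type*} [Fintype V]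
    [DecidableEq V] [Nonempty V] (G : SimpleGraph V) [DecidableRel G.Adj] (n : ℕ)
    (hn : Fintype.card V = n) :
    -√((⌊(n : ℝ) / 2⌋₊ : ℝ) * (⌈(n : ℝ) / 2⌉₊ : ℝ)) ≤ leastEigenvalue G ∧
      (leastEigenvalue G = -√((⌊(n : ℝ) / 2⌋₊ : ℝ) * (⌈(n : ℝ) / 2⌉₊ : ℝ)) ↔
        Nonempty (G ≃g completeBipartiteGraph (Fin ⌊(n : ℝ) / 2⌋₊) (Fin ⌈(n : ℝ) / 2⌉₊))) := by
  rw [ceil_natCast_div_two, Nat.floor_div_ofNat, Nat.floor_natCast, Nat.cast_sub (n.div_le_self 2)]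
  exact theorem1p3_general G n (n / 2) hn (by omega) (free_of_card_lt (by simp; omega))

theorem theorem1p3 {V : Type*} [Fintype V] [DecidableEq V] [Nonempty V]
    (G : SimpleGraph V) [DecidableRel G.Adj] (n t : ℕ) (hn : Fintype.card V = n) (ht : 3 ≤ t)
    (hG : (SimpleGraph.cycleGraph t).Free G) :
    (Odd t ∨ n < t →
      -√((⌊(n : ℝ) / 2⌋₊ : ℝ) * (⌈(n : ℝ) / 2⌉₊ : ℝ)) ≤ leastEigenvalue G ∧
      (leastEigenvalue G = -√((⌊(n : ℝ) / 2⌋₊ : ℝ) * (⌈(n : ℝ) / 2⌉₊ : ℝ)) ↔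
        Nonempty (G ≃g completeBipartiteGraph (Fin ⌊(n : ℝ) / 2⌋₊) (Fin ⌈(n : ℝ) / 2⌉₊)))) ∧
    (∀ k : ℕ, t = 2 * k + 2 → t ≤ n →
      -√((k : ℝ) * ((n : ℝ) - (k : ℝ))) ≤ leastEigenvalue G ∧
      (leastEigenvalue G = -√((k : ℝ) * ((n : ℝ) - (k : ℝ))) ↔
        Nonempty (G ≃g completeBipartiteGraph (Fin k) (Fin (n - k))))) :=
  ⟨fun _ => neg_sqrt_floor_mul_ceil_le_leastEigenvalue_and_eq_iff G n hn, by
    rintro k rfl hkn; exact theorem1p3_general G n k hn (by omega) hG⟩
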